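/- Let $d\in\mathbb N=\{1,2,\dots\}$, $\mathcal L\in C^2(\mathbb R^d,\mathbb R)$, $\vartheta\in\mathbb R^d$, $\kappa,\mathcal K\in(0,\infty)$ satisfy for all $\theta,\phi\in\mathbb R^d$ that $$\|\nabla\mathcal L(\theta)-\nabla\mathcal L(\phi)\|\le\mathcal K\|\theta-\phi\|\qquad\text{and}\qquad\langle\theta-\vartheta,\nabla\mathcal L(\theta)\rangle\ge\kappa\|\theta-\vartheta\|^2,$$ where $\|\cdot\|$ and $\langle\cdot,\cdot\rangle$ are the Euclidean norm and inner product. Let $\varepsilon\in(0,1)$ and, for all $\alpha,\beta\in(0,1)$, $\gamma\in\mathbb R$, let $\Theta^{\alpha,\beta,\gamma},\mathbf m^{\alpha,\beta,\gamma},\mathbb M^{\alpha,\beta,\gamma}\colon\mathbb N_0\to\mathbb R^d$ be a run of the Adam optimizer with arbitrary initial values, that is (omitting the superscripts $\alpha,\beta,\gamma$ and writing $v^{i}$ for the $i$-th component of $v \in \mathbb R^d$), for all $n\in\mathbb N$, $i\in\{1,\dots,d\}$ we have $\mathbb M_n^{i}\ge 0$ and $$\mathbf m_n^{i}=\alpha\,\mathbf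 m_{n-1}^{i}+(1-\alpha)\,(\nabla\mathcal L(\Theta_{n-1}))^{i},\qquad \mathbb M_n^{i}=\beta\,\mathbb M_{n-1}^{i}+(1-\beta)\,\bigl|(\nabla\mathcal L(\Theta_{n-1}))^{i}\bigr|^2,$$ $$\Theta_n^{i}=\Theta_{n-1}^{i}-\gamma\,(1-\alpha^n)^{-1}\Bigl[\varepsilon+(1-\beta^n)^{-1/2}\sqrt{\mathbb M_n^{i}}\,\Bigr]^{-1}\mathbf m_n^{i}.$$ Then for every $\bar\gamma\in(0,\tfrac1{4\mathcal K})$ there exist $\alpha,\beta\in(0,1)$ such that for all $\delta\in(0,\infty)$ $$\inf_{\gamma\in(0,\bar\gamma)}\ \limsup_{n\to\infty}\left(\Bigl(\tfrac{1-\bar\gamma\kappa}{1+\bar\gamma\kappa}+\delta\Bigr)^{-n}\bigl\|\Theta_n^{\alpha,\beta,\gamma}-\vartheta\bigr\|\right)=0,$$ where the limit superior and the infimum are taken in $[0,\infty]$. -/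

import Mathlib

open Filter
open scoped Gradient

/-- `IsAdam G α β γ ε Θ m M` says that `(Θ, m, M)` is a run of the (bias-corrected, deterministic)
Adam optimizer for the gradient field `G` with momentum parameter `α`, second moment parameter `β`,
learning rate `γ` and regularization `ε`. Squares, square roots and inverses of vectors are taken
componentwise. The initial values `Θ 0`, `m 0`, `M 0` are arbitrary; step `n ≥ 1` is written
as step `n + 1` with `n ≥ 0`. -/
structure IsAdam {d : ℕ} (G : EuclideanSpace ℝ (Fin d) → EuclideanSpace ℝ (Fin d))
    (α β γ ε : ℝ) (Θ m M : ℕ → EuclideanSpace ℝ (Fin d)) : Prop where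
  first_moment : ∀ n i, m (n + 1) i = α * m n i + (1 - α) * G (Θ n) i
  second_moment : ∀ n i, M (n + 1) i = β * M n i + (1 - β) * (G (Θ n) i) ^ 2
  update : ∀ n i, Θ (n + 1) i =
    Θ n i - γ * (1 - α ^ (n + 1))⁻¹ *
      (ε + (1 - β ^ (n + 1)) ^ (-(1 / 2) : ℝ) * √(M (n + 1) i))⁻¹ * m (n + 1) i

/-! ### Lipschitz and coercive gradients, and the Hessian at the minimizer -/

section Gradient

variable {E : Type*} [NormedAddCommGroup E] [InnerProductSpace ℝ E] [CompleteSpace E]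

/-! Take `α = β = ρ²` with `ρ = (1 - γbar κ) / (1 + γbar κ)`, and `γ = ε η` with `η` slightly above
`γbar`. Near `ϑ` the second moment vanishes, so the effective step sizes `A` tend to `γ / ε = η` and
Adam becomes heavy-ball momentum, with linearization `x (n+2) = S x (n+1) - ρ² x n`, `S = (1 + ρ²) -
η (1 - ρ²) H`, `H` the Hessian at `ϑ`. An eigenvalue `μ` of `S` contributes the roots of `z² - μ z +
ρ²`, which have modulus `ρ` when `|μ| < 2ρ`; since `κ ≤ H ≤ K`, this holds as soon as `η > γbar`. An
invariant quadratic form replaces the spectral argument and absorbs the `o(x)` errors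
(`isBigO_pow_of_secondOrder`, `momentum_isBigO_pow`).

Global convergence comes from the Lyapunov function `(1 - ρ²) f(Θ) + (ρ/2) ∑ A m²`
(`momentum_bounded_and_tendsto`, `momentum_tendsto`). It decreases because `M` loses at most a
factor `β = ρ²` per step, so `A` grows at most by the factor `1/ρ`. -/

theorem hasDerivAt_comp_add_smul_gradient {f : E → ℝ} (hf : Differentiable ℝ f) (x v : E) (t : ℝ) :
    HasDerivAt (fun t : ℝ => f (x + t • v)) (inner ℝ (∇ f (x + t • v)) v) t := by
  have h1 : HasDerivAt (fun t : ℝ => x + t • v) v t := by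
    simpa using ((hasDerivAt_id t).smul_const v).const_add x
  have h2 := (hf (x + t • v)).hasFDerivAt.comp_hasDerivAt t h1
  have h3 : fderiv ℝ f (x + t • v) v = inner ℝ (∇ f (x + t • v)) v := by
    simp [gradient, InnerProductSpace.toDual_symm_apply]
  rw [← h3]
  exact h2

theorem le_add_inner_gradient_add_norm_sq {f : E → ℝ} (hf : Differentiable ℝ f) {K : ℝ}
    (hLip : ∀ x y : E, ‖∇ f x - ∇ f y‖ ≤ K * ‖x - y‖) (x v : E) :
    f (x + v) ≤ f x + inner ℝ (∇ f x) v + K / 2 * ‖v‖ ^ 2 := by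
  have hd : ∀ t : ℝ, HasDerivAt
      (fun t : ℝ => f (x + t • v) - t * inner ℝ (∇ f x) v - K / 2 * ‖v‖ ^ 2 * t ^ 2)
      (inner ℝ (∇ f (x + t • v)) v - inner ℝ (∇ f x) v - K * ‖v‖ ^ 2 * t) t := by
    intro t
    have := ((hasDerivAt_comp_add_smul_gradient hf x v t).sub
      ((hasDerivAt_id t).mul_const (inner ℝ (∇ f x) v))).sub
      (((hasDerivAt_id t).pow 2).const_mul (K / 2 * ‖v‖ ^ 2))
    exact this.congr_deriv (by simp; ring)
  have hanti : AntitoneOn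
      (fun t : ℝ => f (x + t • v) - t * inner ℝ (∇ f x) v - K / 2 * ‖v‖ ^ 2 * t ^ 2)
      (Set.Ici 0) := by
    refine antitoneOn_of_deriv_nonpos (convex_Ici 0)
      (fun t _ => (hd t).continuousAt.continuousWithinAt)
      (fun t _ => (hd t).differentiableAt.differentiableWithinAt) fun t ht => ?_
    rw [interior_Ici] at ht
    have ht : 0 < t := ht
    rw [(hd t).deriv, ← inner_sub_left]
    have h1 := real_inner_le_norm (∇ f (x + t • v) - ∇ f x) v
    have h2 := hLip (x + t • v) x
    rw [add_sub_cancel_left, norm_smul, Real.norm_eq_abs, abs_of_pos ht] at h2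
    have h3 := mul_le_mul_of_nonneg_right h2 (norm_nonneg v)
    linarith
  have := hanti (Set.mem_Ici.2 le_rfl) (Set.mem_Ici.2 zero_le_one) zero_le_one
  simp only [one_smul, zero_smul, add_zero] at this
  linarith

variable {f : E → ℝ} {κ : ℝ} {ϑ : E}

/-- Integrating coercivity along rays from `ϑ` gives quadratic growth, so a bound on the Lyapunov
function bounds the iterates. -/
theorem add_norm_sq_le_of_coercive (hf : Differentiable ℝ f)
    (hcoer : ∀ θ : E, κ * ‖θ - ϑ‖ ^ 2 ≤ inner ℝ (θ - ϑ) (∇ f θ)) (θ : E) :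
    f ϑ + κ / 2 * ‖θ - ϑ‖ ^ 2 ≤ f θ := by
  set v := θ - ϑ with hv
  have hd : ∀ t : ℝ, HasDerivAt
      (fun t : ℝ => f (ϑ + t • v) - κ / 2 * ‖v‖ ^ 2 * t ^ 2)
      (inner ℝ (∇ f (ϑ + t • v)) v - κ * ‖v‖ ^ 2 * t) t := by
    intro t
    have := (hasDerivAt_comp_add_smul_gradient hf ϑ v t).sub
      (((hasDerivAt_id t).pow 2).const_mul (κ / 2 * ‖v‖ ^ 2))
    exact this.congr_deriv (by simp; ring)
  have hmono : MonotoneOn (fun t : ℝ => f (ϑ + t • v) - κ / 2 * ‖v‖ ^ 2 * t ^ 2)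
      (Set.Ici 0) := by
    refine monotoneOn_of_deriv_nonneg (convex_Ici 0)
      (fun t _ => (hd t).continuousAt.continuousWithinAt)
      (fun t _ => (hd t).differentiableAt.differentiableWithinAt) fun t ht => ?_
    rw [interior_Ici] at ht
    have ht : 0 < t := ht
    rw [(hd t).deriv]
    have h1 := hcoer (ϑ + t • v)
    rw [add_sub_cancel_left, norm_smul, Real.norm_eq_abs, abs_of_pos ht, real_inner_smul_left,
      real_inner_comm, mul_pow] at h1
    have h2 : t * (κ * ‖v‖ ^ 2 * t) ≤ t * inner ℝ (∇ f (ϑ + t • v)) v := by linarith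
    linarith [le_of_mul_le_mul_left h2 ht]
  have := hmono (Set.mem_Ici.2 le_rfl) (Set.mem_Ici.2 zero_le_one) zero_le_one
  simp [hv] at this
  linarith

theorem inner_slope_gradient_ge (hcoer : ∀ θ : E, κ * ‖θ - ϑ‖ ^ 2 ≤ inner ℝ (θ - ϑ) (∇ f θ))
    (v : E) {t : ℝ} (ht : 0 < t) : κ * ‖v‖ ^ 2 * t ≤ inner ℝ v (∇ f (ϑ + t • v)) := by
  have h1 := hcoer (ϑ + t • v)
  rw [add_sub_cancel_left, norm_smul, Real.norm_eq_abs, abs_of_pos ht, real_inner_smul_left,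
    mul_pow] at h1
  have h2 : t * (κ * ‖v‖ ^ 2 * t) ≤ t * inner ℝ v (∇ f (ϑ + t • v)) := by linarith
  exact le_of_mul_le_mul_left h2 ht

theorem gradient_eq_zero_of_coercive (hκ : 0 < κ) (hc : Continuous (∇ f))
    (hcoer : ∀ θ : E, κ * ‖θ - ϑ‖ ^ 2 ≤ inner ℝ (θ - ϑ) (∇ f θ)) : ∇ f ϑ = 0 := by
  -- Approaching `ϑ` along the direction of steepest descent turns coercivity into `-‖∇ f ϑ‖² ≥ 0`.
  set v := -∇ f ϑ with hv
  have hlim : Tendsto (fun t : ℝ => inner ℝ v (∇ f (ϑ + t • v))) (nhdsWithin 0 (Set.Ioi 0))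
      (nhds (inner ℝ v (∇ f (ϑ + (0 : ℝ) • v)))) := by
    have : Continuous (fun t : ℝ => inner ℝ v (∇ f (ϑ + t • v))) := by fun_prop
    exact (this.tendsto 0).mono_left nhdsWithin_le_nhds
  have h0 : 0 ≤ inner ℝ v (∇ f (ϑ + (0 : ℝ) • v)) := by
    refine ge_of_tendsto hlim ?_
    filter_upwards [self_mem_nhdsWithin] with t ht
    have ht : 0 < t := ht
    exact le_trans (by positivity) (inner_slope_gradient_ge hcoer v ht)
  rw [zero_smul, add_zero, hv, inner_neg_left, real_inner_self_eq_norm_sq] at h0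
  have : ‖∇ f ϑ‖ ^ 2 = 0 := le_antisymm (by linarith) (sq_nonneg _)
  simpa using this

/-- Symmetry of the second derivative is what lets quadratic forms do the work of a spectral
decomposition later. -/
theorem exists_hasFDerivAt_gradient_symmetric (hf : ContDiff ℝ 2 f) (x : E) :
    ∃ H : E →L[ℝ] E, HasFDerivAt (∇ f) H x ∧ ∀ u v, inner ℝ (H u) v = inner ℝ u (H v) := by
  have h1 : Differentiable ℝ (fderiv ℝ f) :=
    (hf.fderiv_right (m := 1) (by norm_num)).differentiable (by norm_num)
  let J : (E →L[ℝ] ℝ) →L[ℝ] E :=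
    { toFun := (InnerProductSpace.toDual ℝ E).symm
      map_add' := map_add _
      map_smul' := fun c φ => by simp
      cont := (InnerProductSpace.toDual ℝ E).symm.continuous }
  refine ⟨J.comp (fderiv ℝ (fderiv ℝ f) x), J.hasFDerivAt.comp x (h1 x).hasFDerivAt, ?_⟩
  have hJ : ∀ (φ : E →L[ℝ] ℝ) (v : E), inner ℝ (J φ) v = φ v := fun φ v =>
    InnerProductSpace.toDual_symm_apply (𝕜 := ℝ)
  have hsymm : IsSymmSndFDerivAt ℝ f x := hf.contDiffAt.isSymmSndFDerivAt (by simp)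
  intro u v
  rw [ContinuousLinearMap.comp_apply, ContinuousLinearMap.comp_apply, hJ, real_inner_comm, hJ]
  exact hsymm u v

theorem inner_fderiv_gradient_ge_of_coercive {H : E →L[ℝ] E} (hH : HasFDerivAt (∇ f) H ϑ)
    (h0 : ∇ f ϑ = 0)
    (hcoer : ∀ θ : E, κ * ‖θ - ϑ‖ ^ 2 ≤ inner ℝ (θ - ϑ) (∇ f θ)) (v : E) :
    κ * ‖v‖ ^ 2 ≤ inner ℝ v (H v) := by
  have hline : HasDerivAt (fun t : ℝ => ϑ + t • v) v 0 := by
    simpa using ((hasDerivAt_id (0 : ℝ)).smul_const v).const_add ϑ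
  have hH' : HasFDerivAt (∇ f) H (ϑ + (0 : ℝ) • v) := by simpa using hH
  have h1 : HasDerivAt (fun t : ℝ => ∇ f (ϑ + t • v)) (H v) 0 :=
    HasFDerivAt.comp_hasDerivAt (f := fun t : ℝ => ϑ + t • v) 0 hH' hline
  have h2 := hasDerivAt_iff_tendsto_slope_zero.1 h1
  have h3 : Tendsto (fun t : ℝ => inner ℝ v (t⁻¹ • (∇ f (ϑ + (0 + t) • v) - ∇ f (ϑ + (0 : ℝ) • v))))
      (nhdsWithin 0 (Set.Ioi 0)) (nhds (inner ℝ v (H v))) :=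
    (tendsto_const_nhds.inner h2).mono_left
      (nhdsWithin_mono _ fun t ht => ne_of_gt ht)
  refine ge_of_tendsto h3 ?_
  filter_upwards [self_mem_nhdsWithin] with t ht
  have ht : 0 < t := ht
  have := inner_slope_gradient_ge hcoer v ht
  rw [zero_smul, add_zero, h0, zero_add, sub_zero, real_inner_smul_right, inv_mul_eq_div,
    le_div_iff₀ ht]
  exact this

end Gradient

/-! ### Scalar recursions with a contraction factor -/

/-- A sequence dominated by a contraction up to a vanishing error tends to zero. -/
theorem tendsto_zero_of_le_mul_add {β : ℝ} (hβ0 : 0 ≤ β) (hβ1 : β < 1) {y u : ℕ → ℝ}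
    (hy : ∀ᶠ n in atTop, 0 ≤ y n) (hu : Tendsto u atTop (nhds 0))
    (hyu : ∀ᶠ n in atTop, y (n + 1) ≤ β * y n + u n) : Tendsto y atTop (nhds 0) := by
  rw [Metric.tendsto_atTop]
  intro e he
  have hβ : 0 < 1 - β := by linarith
  have hue : ∀ᶠ n in atTop, u n ≤ (1 - β) * (e / 2) :=
    hu.eventually (ge_mem_nhds (by positivity))
  obtain ⟨N, hN⟩ := eventually_atTop.1 (hy.and (hyu.and hue))
  have key : ∀ k, y (N + k) ≤ e / 2 + β ^ k * y N := by
    intro k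
    induction k with
    | zero => simp; positivity
    | succ k ih =>
      have h1 := hN (N + k) (by omega)
      have h2 := mul_le_mul_of_nonneg_left ih hβ0
      rw [← add_assoc, pow_succ]
      linarith [h1.2.1, h1.2.2]
  have hlim : Tendsto (fun k => β ^ k * y N) atTop (nhds 0) := by
    simpa using (tendsto_pow_atTop_nhds_zero_of_lt_one hβ0 hβ1).mul_const (y N)
  obtain ⟨k₀, hk₀⟩ := eventually_atTop.1 (hlim.eventually (gt_mem_nhds (half_pos he)))
  refine ⟨N + k₀, fun n hn => ?_⟩
  obtain ⟨k, rfl⟩ := Nat.exists_eq_add_of_le (show N ≤ n by omega)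
  have h1 := key k
  have h2 := hk₀ k (by omega)
  rw [Real.dist_eq, sub_zero, abs_of_nonneg (hN _ (by omega)).1]
  linarith

theorem exists_eventually_le_of_le_mul_add {β C : ℝ} (hβ0 : 0 ≤ β) (hβ1 : β < 1) {y : ℕ → ℝ}
    (hy : ∀ᶠ n in atTop, y (n + 1) ≤ β * y n + (1 - β) * C) :
    ∃ D, ∀ᶠ n in atTop, y n ≤ D := by
  obtain ⟨N, hN⟩ := eventually_atTop.1 hy
  refine ⟨max C (y N), eventually_atTop.2 ⟨N, fun n hn => ?_⟩⟩
  induction n, hn using Nat.le_induction with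
  | base => exact le_max_right _ _
  | succ n hn ih =>
    have h1 := hN n hn
    have h2 := mul_le_mul_of_nonneg_left ih hβ0
    have h3 := mul_le_mul_of_nonneg_left (le_max_left C (y N)) (sub_nonneg.2 hβ1.le)
    linarith

/-! ### Perturbed second-order linear recursions with symmetric coefficient -/

section SecondOrder

variable {E : Type*} [NormedAddCommGroup E] [InnerProductSpace ℝ E]

/-- Polarization followed by the parallelogram law. -/
theorem abs_inner_map_le_of_symmetric {S : E →L[ℝ] E} {s : ℝ}
    (hsymm : ∀ u v, inner ℝ (S u) v = inner ℝ u (S v))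
    (hs : ∀ v, |inner ℝ (S v) v| ≤ s * ‖v‖ ^ 2) (u v : E) :
    |inner ℝ (S u) v| ≤ s / 2 * (‖u‖ ^ 2 + ‖v‖ ^ 2) := by
  have h1 : 4 * inner ℝ (S u) v = inner ℝ (S (u + v)) (u + v) - inner ℝ (S (u - v)) (u - v) := by
    have : inner ℝ (S v) u = inner ℝ (S u) v := by rw [hsymm, real_inner_comm]
    simp only [map_add, map_sub, inner_add_left, inner_add_right, inner_sub_left, inner_sub_right,
      this]
    ring
  have h2 := abs_le.1 (hs (u + v))
  have h3 := abs_le.1 (hs (u - v))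
  have h4 := parallelogram_law_with_norm ℝ u v
  have h5 : s * (‖u + v‖ ^ 2 + ‖u - v‖ ^ 2) = s * (2 * (‖u‖ ^ 2 + ‖v‖ ^ 2)) := by
    rw [h4]
  rw [abs_le]
  constructor <;> linarith [h2.1, h2.2, h3.1, h3.2]

/-- The quadratic form that `(x, y) ↦ (S x - ρ² y, x)` multiplies by `ρ²`. -/
noncomputable def secondOrderEnergy (S : E →L[ℝ] E) (ρ : ℝ) (x y : E) : ℝ :=
  ‖x‖ ^ 2 - inner ℝ (S x) y + ρ ^ 2 * ‖y‖ ^ 2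

/-- For scalar `S = μ` the energy is `(x - z₁ y) (x - z₂ y)` with `z₁`, `z₂` the roots of `z² - μ z
+ ρ²`; the unperturbed recursion multiplies the factors by `z₂` and `z₁`, hence the product by `ρ²`.
-/
theorem secondOrderEnergy_step {S : E →L[ℝ] E} (ρ : ℝ)
    (hsymm : ∀ u v, inner ℝ (S u) v = inner ℝ u (S v)) (x y r : E) :
    secondOrderEnergy S ρ (S x - ρ ^ 2 • y + r) x = ρ ^ 2 * secondOrderEnergy S ρ x y +
      inner ℝ r (S x - (2 * ρ ^ 2) • y) + ‖r‖ ^ 2 := by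
  unfold secondOrderEnergy
  rw [hsymm (S x - ρ ^ 2 • y + r) x]
  simp only [← real_inner_self_eq_norm_sq, inner_add_left, inner_add_right, inner_sub_left,
    inner_sub_right, real_inner_smul_left, real_inner_smul_right]
  rw [real_inner_comm (S x) r, real_inner_comm y r, real_inner_comm (S x) y]
  ring

theorem le_secondOrderEnergy {S : E →L[ℝ] E} {ρ s : ℝ} (hρ : 0 < ρ)
    (hsymm : ∀ u v, inner ℝ (S u) v = inner ℝ u (S v))
    (hs : ∀ v, |inner ℝ (S v) v| ≤ s * ‖v‖ ^ 2) (x y : E) :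
    (1 - s / (2 * ρ)) * (‖x‖ ^ 2 + ρ ^ 2 * ‖y‖ ^ 2) ≤ secondOrderEnergy S ρ x y := by
  -- Rescaling `y` by `ρ` balances the two squares, so that `s < 2ρ` becomes the condition for
  -- positive definiteness.
  have h1 := (abs_le.1 (abs_inner_map_le_of_symmetric hsymm hs x (ρ • y))).2
  rw [real_inner_smul_right, norm_smul, Real.norm_eq_abs, abs_of_pos hρ, mul_pow] at h1
  have h2 : inner ℝ (S x) y ≤ s / (2 * ρ) * (‖x‖ ^ 2 + ρ ^ 2 * ‖y‖ ^ 2) := by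
    rw [← mul_le_mul_iff_right₀ hρ]
    refine h1.trans (le_of_eq ?_)
    field_simp
  unfold secondOrderEnergy
  linarith

theorem isBigO_pow_of_secondOrder {S : E →L[ℝ] E} {ρ s σ : ℝ} (hρ : 0 < ρ) (hsρ : s < 2 * ρ)
    (hσ : ρ < σ) (hsymm : ∀ u v, inner ℝ (S u) v = inner ℝ u (S v))
    (hs : ∀ v, |inner ℝ (S v) v| ≤ s * ‖v‖ ^ 2) {x r : ℕ → E}
    (hx : ∀ᶠ n in atTop, x (n + 2) = S (x (n + 1)) - ρ ^ 2 • x n + r n)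
    (hr : r =o[atTop] fun n => ‖x (n + 1)‖ + ‖x n‖) :
    x =O[atTop] fun n => σ ^ n := by
  have hσ0 : 0 < σ := hρ.trans hσ
  set c : ℝ := (1 - s / (2 * ρ)) * min 1 (ρ ^ 2) with hc
  have hc1 : 0 < 1 - s / (2 * ρ) := by
    rw [sub_pos, div_lt_one (by positivity)]; exact hsρ
  have hc0 : 0 < c := mul_pos hc1 (lt_min one_pos (by positivity))
  have hV : ∀ u v, c * (‖u‖ ^ 2 + ‖v‖ ^ 2) ≤ secondOrderEnergy S ρ u v := by
    intro u v
    refine le_trans ?_ (le_secondOrderEnergy hρ hsymm hs u v)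
    rw [hc, mul_assoc]
    refine mul_le_mul_of_nonneg_left ?_ hc1.le
    have h1 := mul_le_mul_of_nonneg_right (min_le_left 1 (ρ ^ 2)) (sq_nonneg ‖u‖)
    have h2 := mul_le_mul_of_nonneg_right (min_le_right 1 (ρ ^ 2)) (sq_nonneg ‖v‖)
    linarith
  set C : ℝ := ‖S‖ + 2 * ρ ^ 2 + 1 with hC
  have hCpos : 0 < C := by positivity
  -- The error bound `2 e C (‖x (n+1)‖² + ‖x n‖²)` must fit into the gap `(σ² - ρ²) V`; the cap at
  -- `1` gives `e² ≤ e`.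
  set e : ℝ := min 1 ((σ ^ 2 - ρ ^ 2) * c / (2 * C)) with he
  have hgap : 0 < σ ^ 2 - ρ ^ 2 := by nlinarith
  have hepos : 0 < e := lt_min one_pos (by positivity)
  have he1 : e ≤ 1 := min_le_left _ _
  have he2 : e * C * 2 ≤ (σ ^ 2 - ρ ^ 2) * c := by
    have := (le_div_iff₀ (by positivity : 0 < 2 * C)).1 (min_le_right 1 ((σ ^ 2 - ρ ^ 2) * c / (2 * C)))
    linarith
  set V : ℕ → ℝ := fun n => secondOrderEnergy S ρ (x (n + 1)) (x n) with hVdef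
  have hstep : ∀ᶠ n in atTop, V (n + 1) ≤ σ ^ 2 * V n := by
    filter_upwards [hx, hr.def hepos] with n hn hrn
    have hE := secondOrderEnergy_step ρ hsymm (x (n + 1)) (x n) (r n)
    rw [← hn] at hE
    set a := ‖x (n + 1)‖
    set b := ‖x n‖
    have ha : 0 ≤ a := norm_nonneg _
    have hb : 0 ≤ b := norm_nonneg _
    rw [Real.norm_eq_abs, abs_of_nonneg (add_nonneg ha hb)] at hrn
    have hw : ‖S (x (n + 1)) - (2 * ρ ^ 2) • x n‖ ≤ (‖S‖ + 2 * ρ ^ 2) * (a + b) := by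
      refine (norm_sub_le _ _).trans ?_
      rw [norm_smul, Real.norm_eq_abs, abs_of_pos (by positivity : (0 : ℝ) < 2 * ρ ^ 2)]
      have h1 := S.le_opNorm (x (n + 1))
      have h2 := mul_nonneg (norm_nonneg S) hb
      have h3 : 0 ≤ 2 * ρ ^ 2 * a := by positivity
      linarith
    have h1 : inner ℝ (r n) (S (x (n + 1)) - (2 * ρ ^ 2) • x n)
        ≤ e * (a + b) * ((‖S‖ + 2 * ρ ^ 2) * (a + b)) :=
      (real_inner_le_norm _ _).trans
        (mul_le_mul hrn hw (norm_nonneg _) (by positivity))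
    have h2 : ‖r n‖ ^ 2 ≤ e * (a + b) ^ 2 := by
      have h3 := pow_le_pow_left₀ (norm_nonneg _) hrn 2
      have h4 : e ^ 2 * (a + b) ^ 2 ≤ e * (a + b) ^ 2 :=
        mul_le_mul_of_nonneg_right (by nlinarith) (sq_nonneg _)
      linarith [mul_pow e (a + b) 2]
    have h3 : inner ℝ (r n) (S (x (n + 1)) - (2 * ρ ^ 2) • x n) + ‖r n‖ ^ 2
        ≤ e * C * (a + b) ^ 2 := by
      rw [hC]; linarith
    have h4 : (a + b) ^ 2 ≤ 2 * (a ^ 2 + b ^ 2) := by nlinarith [sq_nonneg (a - b)]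
    have h5 : e * C * (a + b) ^ 2 ≤ e * C * 2 * (a ^ 2 + b ^ 2) := by
      rw [mul_assoc (e * C)]; exact mul_le_mul_of_nonneg_left h4 (by positivity)
    have h6 : e * C * 2 * (a ^ 2 + b ^ 2) ≤ (σ ^ 2 - ρ ^ 2) * c * (a ^ 2 + b ^ 2) :=
      mul_le_mul_of_nonneg_right he2 (by positivity)
    have h7 := mul_le_mul_of_nonneg_left (hV (x (n + 1)) (x n)) hgap.le
    show secondOrderEnergy S ρ (x (n + 1 + 1)) (x (n + 1)) ≤ _
    simp only [hVdef]
    linarith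
  obtain ⟨N, hN⟩ := eventually_atTop.1 hstep
  have hgeo : ∀ n, N ≤ n → V n ≤ V N / σ ^ (2 * N) * (σ ^ n) ^ 2 := by
    intro n hn
    induction n, hn using Nat.le_induction with
    | base => rw [mul_comm 2 N, pow_mul]; exact le_of_eq (by field_simp)
    | succ n hn ih =>
      refine (hN n hn).trans ((mul_le_mul_of_nonneg_left ih (sq_nonneg σ)).trans (le_of_eq ?_))
      ring
  refine Asymptotics.IsBigO.of_bound (√(V N / σ ^ (2 * N) / c)) ?_
  filter_upwards [eventually_ge_atTop N] with n hn
  rw [Real.norm_eq_abs, abs_of_pos (pow_pos hσ0 n)]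
  have h1 := (hV (x (n + 1)) (x n)).trans (hgeo n hn)
  have h2 : ‖x n‖ ^ 2 ≤ V N / σ ^ (2 * N) / c * (σ ^ n) ^ 2 := by
    rw [div_mul_eq_mul_div, le_div_iff₀ hc0]
    have := mul_nonneg hc0.le (sq_nonneg ‖x (n + 1)‖)
    linarith
  rw [← Real.sqrt_sq (norm_nonneg (x n)), ← Real.sqrt_sq (pow_pos hσ0 n).le,
    ← Real.sqrt_mul' _ (sq_nonneg _)]
  exact Real.sqrt_le_sqrt h2

end SecondOrder

/-! ### Global convergence of momentum with coordinatewise variable step sizes -/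

section Momentum

variable {ι : Type*} [Fintype ι] {f : EuclideanSpace ℝ ι → ℝ} {ϑ : EuclideanSpace ℝ ι}
  {κ K ρ : ℝ} {Θ m : ℕ → EuclideanSpace ℝ ι} {A : ℕ → ι → ℝ}

theorem EuclideanSpace.tendsto_zero_iff {l : Filter ℕ} {x : ℕ → EuclideanSpace ℝ ι} :
    Tendsto x l (nhds 0) ↔ ∀ i, Tendsto (fun n => x n i) l (nhds 0) := by
  constructor
  · intro h i
    have hc : Continuous fun y : EuclideanSpace ℝ ι => y i := by fun_prop
    simpa [Function.comp_def] using (hc.tendsto 0).comp h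
  · intro h
    have h1 : Tendsto (fun n => ∑ i, (x n i) ^ 2) l (nhds 0) := by
      simpa using tendsto_finsetSum Finset.univ fun i _ => (h i).pow 2
    rw [tendsto_zero_iff_norm_tendsto_zero]
    have h2 := h1.sqrt
    rw [Real.sqrt_zero] at h2
    refine h2.congr fun n => ?_
    rw [EuclideanSpace.norm_eq]
    simp

/-- Substitute `(1 - ρ²) g = m' - ρ² m`, split `m m'` by Young's inequality, and trade `ρ A'` for
`A`. What remains in front of `A' m'²` is `1 - ρ²/2 - (1 - ρ²)/8 = ρ/2 + (1 - ρ)(7 + 3ρ)/8`; the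
excess over `ρ/2` is the dissipation. -/
theorem momentum_energy_coordinate {ρ A A' g m m' : ℝ} (hρ0 : 0 ≤ ρ) (hρ1 : ρ ≤ 1)
    (hK : 0 < K) (hA' : 0 ≤ A') (hAK : A' ≤ 1 / (4 * K)) (hAρ : ρ * A' ≤ A)
    (hm : m' = ρ ^ 2 * m + (1 - ρ ^ 2) * g) :
    (1 - ρ ^ 2) * (g * -(A' * m') + K / 2 * (A' * m') ^ 2) ≤
      ρ / 2 * (A * m ^ 2) - (ρ / 2 + (1 - ρ) * (7 + 3 * ρ) / 8) * (A' * m' ^ 2) := by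
  have hp : 0 ≤ 1 - ρ ^ 2 := by nlinarith
  have hg : (1 - ρ ^ 2) * g = m' - ρ ^ 2 * m := by linarith
  have h1 : K * A' ≤ 1 / 4 := by
    have := mul_le_mul_of_nonneg_left hAK hK.le
    rwa [show K * (1 / (4 * K)) = 1 / 4 by field_simp] at this
  have h2 : (1 - ρ ^ 2) * (K / 2 * (A' * m') ^ 2) ≤ (1 - ρ ^ 2) / 8 * (A' * m' ^ 2) := by
    have h3 : 0 ≤ (1 - ρ ^ 2) / 2 * (A' * m' ^ 2) := by positivity
    have := mul_le_mul_of_nonneg_right h1 h3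
    nlinarith
  have h4 : ρ ^ 2 * (A' * (m * m')) ≤ ρ ^ 2 * A' * ((m ^ 2 + m' ^ 2) / 2) := by
    rw [← mul_assoc]
    refine mul_le_mul_of_nonneg_left ?_ (by positivity)
    nlinarith [sq_nonneg (m - m')]
  have h5 : ρ ^ 2 * A' * m ^ 2 ≤ ρ * A * m ^ 2 := by
    have := mul_le_mul_of_nonneg_left hAρ hρ0
    exact mul_le_mul_of_nonneg_right (by linarith) (sq_nonneg m)
  have h6 : (1 - ρ ^ 2) * (g * -(A' * m')) = -(A' * m' ^ 2) + ρ ^ 2 * (A' * (m * m')) := by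
    linear_combination (-(A' * m')) * hg
  rw [mul_add, h6]
  linarith

theorem momentum_energy_step (hf : Differentiable ℝ f) (hK : 0 < K)
    (hLip : ∀ x y, ‖∇ f x - ∇ f y‖ ≤ K * ‖x - y‖) (hρ0 : 0 ≤ ρ) (hρ1 : ρ ≤ 1)
    {θ θ' u u' : EuclideanSpace ℝ ι} {a a' : ι → ℝ}
    (hm : ∀ i, u' i = ρ ^ 2 * u i + (1 - ρ ^ 2) * ∇ f θ i)
    (hΘ : ∀ i, θ' i = θ i - a' i * u' i) (ha' : ∀ i, 0 ≤ a' i)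
    (haK : ∀ i, a' i ≤ 1 / (4 * K)) (haρ : ∀ i, ρ * a' i ≤ a i) :
    (1 - ρ ^ 2) * f θ' + (ρ / 2 + (1 - ρ) * (7 + 3 * ρ) / 8) * ∑ i, a' i * u' i ^ 2 ≤
      (1 - ρ ^ 2) * f θ + ρ / 2 * ∑ i, a i * u i ^ 2 := by
  have hp : 0 ≤ 1 - ρ ^ 2 := by nlinarith
  have h1 := le_add_inner_gradient_add_norm_sq hf hLip θ (θ' - θ)
  have hv : ∀ i, (θ' - θ) i = -(a' i * u' i) := fun i => by
    rw [PiLp.sub_apply, hΘ i]; ring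
  have h2 : inner ℝ (∇ f θ) (θ' - θ) + K / 2 * ‖θ' - θ‖ ^ 2 =
      ∑ i, (∇ f θ i * -(a' i * u' i) + K / 2 * (a' i * u' i) ^ 2) := by
    rw [EuclideanSpace.norm_sq_eq, PiLp.inner_apply, Finset.mul_sum, ← Finset.sum_add_distrib]
    refine Finset.sum_congr rfl fun i _ => ?_
    rw [hv i, Real.norm_eq_abs, sq_abs]
    simp
    ring
  have h3 : (1 - ρ ^ 2) * ∑ i, (∇ f θ i * -(a' i * u' i) + K / 2 * (a' i * u' i) ^ 2) ≤
      ρ / 2 * ∑ i, a i * u i ^ 2 -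
        (ρ / 2 + (1 - ρ) * (7 + 3 * ρ) / 8) * ∑ i, a' i * u' i ^ 2 := by
    simp only [Finset.mul_sum]
    rw [← Finset.sum_sub_distrib]
    exact Finset.sum_le_sum fun i _ =>
      momentum_energy_coordinate hρ0 hρ1 hK (ha' i) (haK i) (haρ i) (hm i)
  rw [add_sub_cancel] at h1
  have h4 := mul_le_mul_of_nonneg_left h1 hp
  rw [add_assoc, h2, mul_add] at h4
  linarith

/-- The Lyapunov function is nonincreasing and bounded below, and each decrement controls a multiple
of the next `∑ A m²`. No positive lower bound on `A` is assumed: for Adam it is only available once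
the iterates are known to be bounded. -/
theorem momentum_bounded_and_tendsto (hf : Differentiable ℝ f) (hκ : 0 < κ) (hK : 0 < K)
    (hLip : ∀ x y, ‖∇ f x - ∇ f y‖ ≤ K * ‖x - y‖)
    (hcoer : ∀ θ, κ * ‖θ - ϑ‖ ^ 2 ≤ inner ℝ (θ - ϑ) (∇ f θ))
    (hρ0 : 0 ≤ ρ) (hρ1 : ρ < 1)
    (hm : ∀ n i, m (n + 1) i = ρ ^ 2 * m n i + (1 - ρ ^ 2) * ∇ f (Θ n) i)
    (hΘ : ∀ n i, Θ (n + 1) i = Θ n i - A (n + 1) i * m (n + 1) i)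
    (hA : ∀ᶠ n in atTop, ∀ i, 0 ≤ A n i) (hAK : ∀ᶠ n in atTop, ∀ i, A n i ≤ 1 / (4 * K))
    (hAρ : ∀ᶠ n in atTop, ∀ i, ρ * A (n + 1) i ≤ A n i) :
    (∃ R, ∀ᶠ n in atTop, ‖Θ n - ϑ‖ ≤ R) ∧
      Tendsto (fun n => ∑ i, A n i * m n i ^ 2) atTop (nhds 0) := by
  have hp : 0 < 1 - ρ ^ 2 := by nlinarith
  set Q : ℕ → ℝ := fun n => ∑ i, A n i * m n i ^ 2 with hQ
  set V : ℕ → ℝ := fun n => (1 - ρ ^ 2) * f (Θ n) + ρ / 2 * Q n with hV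
  set c : ℝ := (1 - ρ) * (7 + 3 * ρ) / 8 with hc
  have hc0 : 0 < c := by
    have : 0 < 1 - ρ := by linarith
    positivity
  obtain ⟨N, hN⟩ := eventually_atTop.1 (hA.and (hAK.and hAρ))
  have hQ0 : ∀ n, N ≤ n → 0 ≤ Q n := fun n hn =>
    Finset.sum_nonneg fun i _ => mul_nonneg ((hN n hn).1 i) (sq_nonneg _)
  have hstep : ∀ n, N ≤ n → V (n + 1) + c * Q (n + 1) ≤ V n := by
    intro n hn
    have := momentum_energy_step hf hK hLip hρ0 hρ1.le (hm n) (hΘ n) (hN (n + 1) (by omega)).1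
      (hN (n + 1) (by omega)).2.1 (hN n hn).2.2
    rw [← hc, add_mul] at this
    simp only [hV, hQ]
    linarith
  have hlow : ∀ n, N ≤ n → (1 - ρ ^ 2) * (f ϑ + κ / 2 * ‖Θ n - ϑ‖ ^ 2) ≤ V n := by
    intro n hn
    have h1 := mul_le_mul_of_nonneg_left (add_norm_sq_le_of_coercive hf hcoer (Θ n)) hp.le
    have h2 := mul_nonneg hρ0 (hQ0 n hn)
    simp only [hV]
    linarith
  have hanti : Antitone fun k => V (N + k) := antitone_nat_of_succ_le fun k => by
    have h1 := hstep (N + k) (by omega)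
    have h2 := mul_nonneg hc0.le (hQ0 (N + k + 1) (by omega))
    rw [← add_assoc]
    linarith
  constructor
  · refine ⟨√((V N / (1 - ρ ^ 2) - f ϑ) / (κ / 2)), eventually_atTop.2 ⟨N, fun n hn => ?_⟩⟩
    obtain ⟨k, rfl⟩ := Nat.exists_eq_add_of_le hn
    have h1 : V (N + k) ≤ V N := by simpa using hanti (Nat.zero_le k)
    refine Real.le_sqrt_of_sq_le ?_
    rw [le_div_iff₀ (by positivity), le_sub_iff_add_le, le_div_iff₀ hp]
    linarith [hlow (N + k) hn]
  · have hbdd : BddBelow (Set.range fun k => V (N + k)) := by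
      refine ⟨(1 - ρ ^ 2) * f ϑ, ?_⟩
      rintro _ ⟨k, rfl⟩
      have h2 : 0 ≤ (1 - ρ ^ 2) * (κ / 2 * ‖Θ (N + k) - ϑ‖ ^ 2) := by positivity
      linarith [hlow (N + k) (by omega)]
    have hlim := tendsto_atTop_ciInf hanti hbdd
    have hdiff : Tendsto (fun k => (V (N + k) - V (N + (k + 1))) / c) atTop (nhds 0) := by
      simpa using (hlim.sub ((tendsto_add_atTop_iff_nat 1).2 hlim)).div_const c
    rw [← tendsto_add_atTop_iff_nat (N + 1)]
    refine squeeze_zero (fun k => hQ0 _ (by omega)) (fun k => ?_) hdiff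
    rw [le_div_iff₀ hc0]
    have := hstep (N + k) (by omega)
    rw [show k + (N + 1) = N + k + 1 by ring, ← add_assoc]
    linarith

/-- With `A` bounded below, the momentum vanishes; its recursion then forces the gradient to vanish,
and coercivity gives `κ ‖Θ n - ϑ‖ ≤ ‖∇ f (Θ n)‖`. -/
theorem momentum_tendsto (hκ : 0 < κ)
    (hcoer : ∀ θ, κ * ‖θ - ϑ‖ ^ 2 ≤ inner ℝ (θ - ϑ) (∇ f θ)) (hρ0 : 0 ≤ ρ) (hρ1 : ρ < 1)
    (hm : ∀ n i, m (n + 1) i = ρ ^ 2 * m n i + (1 - ρ ^ 2) * ∇ f (Θ n) i)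
    {a : ℝ} (ha : 0 < a) (hA : ∀ᶠ n in atTop, ∀ i, a ≤ A n i)
    (hQ : Tendsto (fun n => ∑ i, A n i * m n i ^ 2) atTop (nhds 0)) :
    Tendsto (fun n => Θ n - ϑ) atTop (nhds 0) := by
  have hp : 0 < 1 - ρ ^ 2 := by nlinarith
  have hm0 : ∀ i, Tendsto (fun n => m n i) atTop (nhds 0) := by
    intro i
    have h1 : Tendsto (fun n => m n i ^ 2) atTop (nhds 0) := by
      refine squeeze_zero' (Eventually.of_forall fun n => sq_nonneg _) ?_
        (by simpa using hQ.div_const a)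
      filter_upwards [hA] with n hn
      rw [le_div_iff₀ ha, mul_comm]
      refine (mul_le_mul_of_nonneg_right (hn i) (sq_nonneg _)).trans ?_
      exact Finset.single_le_sum (f := fun i => A n i * m n i ^ 2)
        (fun j _ => mul_nonneg (ha.le.trans (hn j)) (sq_nonneg _)) (Finset.mem_univ i)
    have h2 := h1.sqrt
    simp only [Real.sqrt_sq_eq_abs, Real.sqrt_zero] at h2
    exact (tendsto_zero_iff_abs_tendsto_zero _).2 h2
  have hg : Tendsto (fun n => ∇ f (Θ n)) atTop (nhds 0) := by
    rw [EuclideanSpace.tendsto_zero_iff]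
    intro i
    have h1 : Tendsto (fun n => (m (n + 1) i - ρ ^ 2 * m n i) / (1 - ρ ^ 2)) atTop (nhds 0) := by
      simpa using (((tendsto_add_atTop_iff_nat 1).2 (hm0 i)).sub
        ((hm0 i).const_mul (ρ ^ 2))).div_const (1 - ρ ^ 2)
    refine h1.congr fun n => ?_
    rw [hm n i]
    field_simp
    ring
  have hle : ∀ n, ‖Θ n - ϑ‖ ≤ ‖∇ f (Θ n)‖ / κ := by
    intro n
    rw [le_div_iff₀ hκ]
    rcases (norm_nonneg (Θ n - ϑ)).eq_or_lt with h | h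
    · rw [← h, zero_mul]; exact norm_nonneg _
    · have h1 := (hcoer (Θ n)).trans (real_inner_le_norm _ _)
      refine le_of_mul_le_mul_left ?_ h
      linarith
  exact squeeze_zero_norm hle (by simpa using hg.norm.div_const κ)

end Momentum

/-! ### Linearization at the minimizer and the local rate -/

section LocalRate

variable {ι : Type*} [Fintype ι] {f : EuclideanSpace ℝ ι → ℝ} {ϑ : EuclideanSpace ℝ ι}
  {κ K ρ η σ : ℝ} {Θ m : ℕ → EuclideanSpace ℝ ι} {A : ℕ → ι → ℝ}

theorem EuclideanSpace.isLittleO_of_coordinates {l : Filter ℕ} {x : ℕ → EuclideanSpace ℝ ι}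
    {w : ℕ → ℝ} (h : ∀ i, (fun n => x n i) =o[l] w) : x =o[l] w := by
  have h1 : (fun n => (EuclideanSpace.equiv ι ℝ) (x n)) =o[l] w :=
    Asymptotics.isLittleO_pi.2 h
  refine Asymptotics.IsBigO.trans_isLittleO ?_ h1
  have h2 := ((EuclideanSpace.equiv ι ℝ).symm : (ι → ℝ) →L[ℝ] EuclideanSpace ℝ ι).isBigO_comp
    (fun n => (EuclideanSpace.equiv ι ℝ) (x n)) l
  simpa using h2

/-- Eliminating the momentum through `a₁ m₁ = θ₀ - θ₁` leaves three errors, small by the convergence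
of step ratios to `1`, of steps to `η`, and of the gradient to its linearization `h`. -/
theorem momentum_secondOrder_coordinate {a₁ a₂ ρ η θ₀ θ₁ θ₂ t m₁ m₂ g h : ℝ} (ha₁ : a₁ ≠ 0)
    (hθ₁ : θ₁ = θ₀ - a₁ * m₁) (hθ₂ : θ₂ = θ₁ - a₂ * m₂)
    (hm₂ : m₂ = ρ ^ 2 * m₁ + (1 - ρ ^ 2) * g) :
    (θ₂ - t) - ((1 + ρ ^ 2) * (θ₁ - t) - η * (1 - ρ ^ 2) * h - ρ ^ 2 * (θ₀ - t)) =
      ρ ^ 2 * ((a₂ / a₁ - 1) * ((θ₁ - t) - (θ₀ - t))) - (1 - ρ ^ 2) * ((a₂ - η) * g)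
        - (1 - ρ ^ 2) * η * (g - h) := by
  subst hθ₂ hm₂ hθ₁
  field_simp
  ring

theorem momentum_isBigO_pow
    (hLip : ∀ x y, ‖∇ f x - ∇ f y‖ ≤ K * ‖x - y‖) (h0 : ∇ f ϑ = 0)
    {H : EuclideanSpace ℝ ι →L[ℝ] EuclideanSpace ℝ ι} (hH : HasFDerivAt (∇ f) H ϑ)
    (hsymm : ∀ u v, inner ℝ (H u) v = inner ℝ u (H v))
    {s : ℝ} (hs : ∀ v, |(1 + ρ ^ 2) * ‖v‖ ^ 2 - η * (1 - ρ ^ 2) * inner ℝ v (H v)| ≤ s * ‖v‖ ^ 2)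
    (hsρ : s < 2 * ρ) (hρ : 0 < ρ) (hσ : ρ < σ) (hη : η ≠ 0)
    (hm : ∀ n i, m (n + 1) i = ρ ^ 2 * m n i + (1 - ρ ^ 2) * ∇ f (Θ n) i)
    (hΘ : ∀ n i, Θ (n + 1) i = Θ n i - A (n + 1) i * m (n + 1) i)
    (hA : ∀ i, Tendsto (fun n => A n i) atTop (nhds η))
    (hlim : Tendsto (fun n => Θ n - ϑ) atTop (nhds 0)) :
    (fun n => Θ n - ϑ) =O[atTop] fun n => σ ^ n := by
  set S : EuclideanSpace ℝ ι →L[ℝ] EuclideanSpace ℝ ι :=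
    (1 + ρ ^ 2) • ContinuousLinearMap.id ℝ _ - (η * (1 - ρ ^ 2)) • H with hS
  have hSv : ∀ v, S v = (1 + ρ ^ 2) • v - (η * (1 - ρ ^ 2)) • H v := fun v => by simp [hS]
  have hSsymm : ∀ u v, inner ℝ (S u) v = inner ℝ u (S v) := fun u v => by
    rw [hSv, hSv, inner_sub_left, inner_sub_right, real_inner_smul_left, real_inner_smul_left,
      real_inner_smul_right, real_inner_smul_right, hsymm]
  have hSs : ∀ v, |inner ℝ (S v) v| ≤ s * ‖v‖ ^ 2 := fun v => by
    rw [hSv, inner_sub_left, real_inner_smul_left, real_inner_smul_left, hsymm,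
      real_inner_self_eq_norm_sq]
    exact hs v
  set x : ℕ → EuclideanSpace ℝ ι := fun n => Θ n - ϑ with hx
  set w : ℕ → ℝ := fun n => ‖x (n + 1)‖ + ‖x n‖ with hw
  have hw0 : ∀ n, 0 ≤ w n := fun n => add_nonneg (norm_nonneg _) (norm_nonneg _)
  refine isBigO_pow_of_secondOrder (S := S) (ρ := ρ) (s := s) hρ hsρ hσ hSsymm hSs
    (r := fun n => x (n + 2) - (S (x (n + 1)) - ρ ^ 2 • x n))
    (Eventually.of_forall fun n => by abel) ?_
  have hx1 : (fun n => x (n + 1)) =O[atTop] w := by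
    refine Asymptotics.IsBigO.of_bound 1 (Eventually.of_forall fun n => ?_)
    rw [one_mul, Real.norm_eq_abs, abs_of_nonneg (hw0 n)]
    exact le_add_of_nonneg_right (norm_nonneg _)
  have hx0 : x =O[atTop] w := by
    refine Asymptotics.IsBigO.of_bound 1 (Eventually.of_forall fun n => ?_)
    rw [one_mul, Real.norm_eq_abs, abs_of_nonneg (hw0 n)]
    exact le_add_of_nonneg_left (norm_nonneg _)
  have hcoord : ∀ (i : ι) (y : ℕ → EuclideanSpace ℝ ι), (fun n => y n i) =O[atTop] y := by
    intro i y
    refine Asymptotics.IsBigO.of_bound 1 (Eventually.of_forall fun n => ?_)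
    rw [one_mul]
    exact PiLp.norm_apply_le (y n) i
  have hg : (fun n => ∇ f (Θ (n + 1))) =O[atTop] w := by
    refine Asymptotics.IsBigO.trans (Asymptotics.IsBigO.of_bound K
      (Eventually.of_forall fun n => ?_)) hx1
    simpa [h0] using hLip (Θ (n + 1)) ϑ
  have hgH : (fun n => ∇ f (Θ (n + 1)) - H (x (n + 1))) =o[atTop] w := by
    have hΘlim : Tendsto (fun n => Θ (n + 1)) atTop (nhds ϑ) :=
      (tendsto_add_atTop_iff_nat 1).2 (tendsto_sub_nhds_zero_iff.1 hlim)
    have := hH.isLittleO.comp_tendsto hΘlim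
    simp only [h0, sub_zero] at this
    exact this.trans_isBigO hx1
  refine EuclideanSpace.isLittleO_of_coordinates fun i => ?_
  have hratio : (fun n => A (n + 2) i / A (n + 1) i - 1) =o[atTop] fun _ => (1 : ℝ) := by
    rw [Asymptotics.isLittleO_one_iff]
    have := (((tendsto_add_atTop_iff_nat 2).2 (hA i)).div ((tendsto_add_atTop_iff_nat 1).2 (hA i))
      hη).sub_const 1
    rwa [div_self hη, sub_self] at this
  have hdiff : (fun n => A (n + 2) i - η) =o[atTop] fun _ => (1 : ℝ) := by
    rw [Asymptotics.isLittleO_one_iff]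
    exact tendsto_sub_nhds_zero_iff.2 ((tendsto_add_atTop_iff_nat 2).2 (hA i))
  have t1 := (hratio.mul_isBigO (((hcoord i _).trans hx1).sub ((hcoord i _).trans hx0))).const_mul_left
    (ρ ^ 2)
  have t2 := (hdiff.mul_isBigO ((hcoord i _).trans hg)).const_mul_left (1 - ρ ^ 2)
  have t3 := ((hcoord i _).trans_isLittleO hgH).const_mul_left ((1 - ρ ^ 2) * η)
  simp only [one_mul] at t1 t2
  refine ((t1.sub t2).sub t3).congr' ?_ EventuallyEq.rfl
  filter_upwards [((tendsto_add_atTop_iff_nat 1).2 (hA i)).eventually_ne hη] with n hn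
  have := momentum_secondOrder_coordinate (η := η) (t := ϑ i) (h := H (x (n + 1)) i) hn (hΘ n i)
    (hΘ (n + 1) i) (hm (n + 1) i)
  rw [hSv]
  simp only [hx, PiLp.sub_apply, PiLp.smul_apply, smul_eq_mul] at this ⊢
  rw [this]

end LocalRate

/-! ### The Adam denominators -/

section Adam

variable {d : ℕ} {G : EuclideanSpace ℝ (Fin d) → EuclideanSpace ℝ (Fin d)}
  {α ρ γ ε : ℝ} {Θ m M : ℕ → EuclideanSpace ℝ (Fin d)}

/-- The denominator of the `n`-th Adam step, with both bias corrections absorbed, in the case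
where the two moment parameters agree. -/
noncomputable def adamDenom (α ε : ℝ) (M : ℕ → EuclideanSpace ℝ (Fin d)) (n : ℕ) (i : Fin d) : ℝ :=
  (1 - α ^ n) * ε + √((1 - α ^ n) * M n i)

theorem one_sub_pow_pos (hα0 : 0 ≤ α) (hα1 : α < 1) {n : ℕ} (hn : n ≠ 0) : 0 < 1 - α ^ n :=
  sub_pos.2 (pow_lt_one₀ hα0 hα1 hn)

/-- Equal moment parameters make the two bias corrections combine: `(1 - α^n) (1 - α^n)^(-1/2) = √(1
- α^n)`. -/
theorem IsAdam.update_eq (h : IsAdam G α α γ ε Θ m M) (hα0 : 0 ≤ α) (hα1 : α < 1)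
    (n : ℕ) (i : Fin d) :
    Θ (n + 1) i = Θ n i - γ / adamDenom α ε M (n + 1) i * m (n + 1) i := by
  have hp : 0 < 1 - α ^ (n + 1) := one_sub_pow_pos hα0 hα1 n.succ_ne_zero
  have hd : adamDenom α ε M (n + 1) i = (1 - α ^ (n + 1)) *
      (ε + (1 - α ^ (n + 1)) ^ (-(1 / 2) : ℝ) * √(M (n + 1) i)) := by
    rw [Real.rpow_neg hp.le, ← Real.sqrt_eq_rpow, adamDenom, Real.sqrt_mul hp.le]
    have h1 := Real.mul_self_sqrt hp.le
    have h2 : √(1 - α ^ (n + 1)) ≠ 0 := (Real.sqrt_pos.2 hp).ne'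
    field_simp
    linear_combination √(M (n + 1) i) * h1
  rw [h.update n i, hd, div_eq_mul_inv γ, mul_inv, mul_assoc γ]

theorem adamDenom_ge (α ε : ℝ) (M : ℕ → EuclideanSpace ℝ (Fin d)) (n : ℕ) (i : Fin d) :
    (1 - α ^ n) * ε ≤ adamDenom α ε M n i :=
  le_add_of_nonneg_right (Real.sqrt_nonneg _)

theorem adamDenom_pos (hα0 : 0 ≤ α) (hα1 : α < 1) (hε : 0 < ε) {n : ℕ} (hn : n ≠ 0) (i : Fin d) :
    0 < adamDenom α ε M n i :=
  (mul_pos (one_sub_pow_pos hα0 hα1 hn) hε).trans_le (adamDenom_ge α ε M n i)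

/-- The bias factor increases and `M` drops at most by the factor `ρ²`, which the square root turns
into `ρ`. This is the step-size growth condition of the Lyapunov argument. -/
theorem IsAdam.mul_adamDenom_le (h : IsAdam G (ρ ^ 2) (ρ ^ 2) γ ε Θ m M) (hρ0 : 0 ≤ ρ) (hρ1 : ρ ≤ 1)
    (hε : 0 ≤ ε) {n : ℕ} {i : Fin d} (hM : 0 ≤ M n i) :
    ρ * adamDenom (ρ ^ 2) ε M n i ≤ adamDenom (ρ ^ 2) ε M (n + 1) i := by
  have hα0 : 0 ≤ ρ ^ 2 := sq_nonneg ρ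
  have hα1 : ρ ^ 2 ≤ 1 := pow_le_one₀ hρ0 hρ1
  have hp : 0 ≤ 1 - (ρ ^ 2) ^ n := sub_nonneg.2 (pow_le_one₀ hα0 hα1)
  have hpp : 1 - (ρ ^ 2) ^ n ≤ 1 - (ρ ^ 2) ^ (n + 1) :=
    sub_le_sub_left (pow_le_pow_of_le_one hα0 hα1 n.le_succ) 1
  have hMle : ρ ^ 2 * M n i ≤ M (n + 1) i := by
    rw [h.second_moment n i]
    exact le_add_of_nonneg_right (mul_nonneg (sub_nonneg.2 hα1) (sq_nonneg _))
  unfold adamDenom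
  rw [mul_add]
  refine add_le_add ?_ ?_
  · have h1 := mul_nonneg hp hε
    have h2 := mul_le_mul_of_nonneg_right hρ1 h1
    have h3 := mul_le_mul_of_nonneg_right hpp hε
    linarith
  · have h1 : ρ * √((1 - (ρ ^ 2) ^ n) * M n i) = √((1 - (ρ ^ 2) ^ n) * (ρ ^ 2 * M n i)) := by
      rw [mul_left_comm, Real.sqrt_mul hα0, Real.sqrt_sq hρ0]
    rw [h1]
    refine Real.sqrt_le_sqrt ?_
    exact mul_le_mul hpp hMle (mul_nonneg hα0 hM) (hp.trans hpp)

theorem tendsto_adamDenom (hα0 : 0 ≤ α) (hα1 : α < 1) {i : Fin d}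
    (hM : Tendsto (fun n => M n i) atTop (nhds 0)) :
    Tendsto (fun n => adamDenom α ε M n i) atTop (nhds ε) := by
  have h1 : Tendsto (fun n : ℕ => 1 - α ^ n) atTop (nhds 1) := by
    simpa using (tendsto_pow_atTop_nhds_zero_of_lt_one hα0 hα1).const_sub 1
  simpa [adamDenom] using (h1.mul_const ε).add (h1.mul hM).sqrt

theorem IsAdam.adamDenom_bounded (h : IsAdam G α α γ ε Θ m M) (hα0 : 0 ≤ α) (hα1 : α < 1)
    (hε : 0 < ε) {R : ℝ} (hR : ∀ᶠ n in atTop, ‖G (Θ n)‖ ≤ R) (i : Fin d) :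
    ∃ D > 0, ∀ᶠ n in atTop, adamDenom α ε M n i ≤ D := by
  obtain ⟨D, hD⟩ := exists_eventually_le_of_le_mul_add (y := fun n => M n i) (C := R ^ 2)
    hα0 hα1 (by
      filter_upwards [hR] with n hn
      rw [h.second_moment n i]
      have h1 : (G (Θ n) i) ^ 2 ≤ R ^ 2 := by
        rw [← sq_abs]
        exact pow_le_pow_left₀ (abs_nonneg _) ((PiLp.norm_apply_le (G (Θ n)) i).trans hn) 2
      linarith [mul_le_mul_of_nonneg_left h1 (sub_nonneg.2 hα1.le)])
  refine ⟨ε + √|D|, by positivity, ?_⟩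
  filter_upwards [hD] with n hn
  have hp0 : 0 ≤ 1 - α ^ n := sub_nonneg.2 (pow_le_one₀ hα0 hα1.le)
  have hp1 : 1 - α ^ n ≤ 1 := sub_le_self 1 (pow_nonneg hα0 n)
  refine add_le_add (mul_le_of_le_one_left hε.le hp1) (Real.sqrt_le_sqrt ?_)
  calc (1 - α ^ n) * M n i ≤ (1 - α ^ n) * |D| :=
        mul_le_mul_of_nonneg_left (hn.trans (le_abs_self D)) hp0
    _ ≤ |D| := mul_le_of_le_one_left (abs_nonneg D) hp1

theorem IsAdam.tendsto_second_moment (h : IsAdam G α α γ ε Θ m M) (hα0 : 0 ≤ α) (hα1 : α < 1)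
    (hM : ∀ n, 1 ≤ n → ∀ i, 0 ≤ M n i) (hG : Tendsto (fun n => G (Θ n)) atTop (nhds 0))
    (i : Fin d) : Tendsto (fun n => M n i) atTop (nhds 0) := by
  have hu : Tendsto (fun n => (1 - α) * (G (Θ n) i) ^ 2) atTop (nhds 0) := by
    simpa using ((EuclideanSpace.tendsto_zero_iff.1 hG i).pow 2).const_mul (1 - α)
  exact tendsto_zero_of_le_mul_add hα0 hα1
    (eventually_atTop.2 ⟨1, fun n hn => hM n hn i⟩) hu
    (Eventually.of_forall fun n => (h.second_moment n i).le)

end Adam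

/-! ### Choice of parameters and conclusion -/

theorem tendsto_zpow_neg_mul_norm {E : Type*} [NormedAddCommGroup E] {x : ℕ → E} {σ τ : ℝ}
    (hσ : 0 < σ) (hστ : σ < τ) (hx : x =O[atTop] fun n => σ ^ n) :
    Tendsto (fun n : ℕ => τ ^ (-(n : ℤ)) * ‖x n‖) atTop (nhds 0) := by
  have h1 : x =o[atTop] fun n => τ ^ n :=
    hx.trans_isLittleO (isLittleO_pow_pow_of_lt_left hσ.le hστ)
  refine h1.norm_left.tendsto_div_nhds_zero.congr fun n => ?_
  rw [zpow_neg, zpow_natCast, div_eq_inv_mul]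

theorem iInf_limsup_eq_zero {s : Set ℝ} {u : ℝ → ℕ → ℝ} (hu : ∀ γ n, 0 ≤ u γ n) {γ : ℝ}
    (hγ : γ ∈ s) (hlim : Tendsto (u γ) atTop (nhds 0)) :
    (⨅ γ ∈ s, limsup (fun n => (u γ n : EReal)) atTop) = 0 := by
  refine le_antisymm ?_ (le_iInf₂ fun γ' _ => ?_)
  · refine (iInf₂_le γ hγ).trans (le_of_eq ?_)
    exact (continuous_coe_real_ereal.tendsto 0 |>.comp hlim).limsup_eq
  · calc (0 : EReal) = limsup (fun _ : ℕ => (0 : EReal)) atTop := by simp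
      _ ≤ _ := limsup_le_limsup (Eventually.of_forall fun n =>
        EReal.coe_nonneg.2 (hu γ' n))

theorem le_of_coercive_of_lipschitz {E : Type*} [NormedAddCommGroup E] [InnerProductSpace ℝ E]
    [CompleteSpace E] [Nontrivial E] {f : E → ℝ} {ϑ : E} {κ K : ℝ}
    (hLip : ∀ x y, ‖∇ f x - ∇ f y‖ ≤ K * ‖x - y‖)
    (hcoer : ∀ θ, κ * ‖θ - ϑ‖ ^ 2 ≤ inner ℝ (θ - ϑ) (∇ f θ)) (h0 : ∇ f ϑ = 0) : κ ≤ K := by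
  obtain ⟨v, hv⟩ := exists_norm_eq E zero_le_one
  have h1 := (hcoer (ϑ + v)).trans (real_inner_le_norm _ _)
  have h2 := hLip (ϑ + v) ϑ
  simp only [add_sub_cancel_left, h0, sub_zero, hv, one_pow, mul_one, one_mul] at h1 h2
  exact h1.trans h2

/-- A bootstrap: bounded iterates bound the denominators, so steps stay away from zero and `Θ`
converges; then `M` vanishes, the steps tend to `η`, and the linearized rate applies. -/
theorem IsAdam.isBigO_pow {d : ℕ} {f : EuclideanSpace ℝ (Fin d) → ℝ} (hf : ContDiff ℝ 2 f)
    {ϑ : EuclideanSpace ℝ (Fin d)} {κ K : ℝ} (hκ : 0 < κ) (hK : 0 < K)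
    (hLip : ∀ x y, ‖∇ f x - ∇ f y‖ ≤ K * ‖x - y‖)
    (hcoer : ∀ θ, κ * ‖θ - ϑ‖ ^ 2 ≤ inner ℝ (θ - ϑ) (∇ f θ)) {ρ η ε : ℝ} (hρ0 : 0 < ρ)
    (hρ1 : ρ < 1) (hη0 : 0 < η) (hηK : η < 1 / (4 * K)) (hε : 0 < ε)
    (hrate : (1 - ρ) < η * κ * (1 + ρ)) {Θ m M : ℕ → EuclideanSpace ℝ (Fin d)}
    (h : IsAdam (∇ f) (ρ ^ 2) (ρ ^ 2) (ε * η) ε Θ m M) (hM : ∀ n, 1 ≤ n → ∀ i, 0 ≤ M n i)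
    {σ : ℝ} (hσ : ρ < σ) : (fun n => Θ n - ϑ) =O[atTop] fun n => σ ^ n := by
  have hα0 : 0 ≤ ρ ^ 2 := sq_nonneg ρ
  have hα1 : ρ ^ 2 < 1 := pow_lt_one₀ hρ0.le hρ1 two_ne_zero
  have hp : 0 < 1 - ρ ^ 2 := sub_pos.2 hα1
  have hγ : 0 < ε * η := mul_pos hε hη0
  have hd : Differentiable ℝ f := hf.differentiable (by norm_num)
  have hLip' : LipschitzWith K.toNNReal (∇ f) := LipschitzWith.of_dist_le_mul fun x y => by
    rw [dist_eq_norm, dist_eq_norm, Real.coe_toNNReal _ hK.le]; exact hLip x y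
  have h0 : ∇ f ϑ = 0 := gradient_eq_zero_of_coercive hκ hLip'.continuous hcoer
  set A : ℕ → Fin d → ℝ := fun n i => ε * η / adamDenom (ρ ^ 2) ε M n i with hAdef
  have hdpos : ∀ n, 1 ≤ n → ∀ i, 0 < adamDenom (ρ ^ 2) ε M n i := fun n hn i =>
    adamDenom_pos hα0 hα1 hε (by omega) i
  have hA0 : ∀ᶠ n in atTop, ∀ i, 0 ≤ A n i := by
    filter_upwards [eventually_ge_atTop 1] with n hn i
    exact (div_pos hγ (hdpos n hn i)).le
  have hAK : ∀ᶠ n in atTop, ∀ i, A n i ≤ 1 / (4 * K) := by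
    -- The strict inequality `η < 1 / (4K)` leaves room for the bias correction at large `n`.
    have hlim : Tendsto (fun n : ℕ => η / (1 - (ρ ^ 2) ^ n)) atTop (nhds η) := by
      have h1 := (tendsto_pow_atTop_nhds_zero_of_lt_one hα0 hα1).const_sub 1
      rw [sub_zero] at h1
      have h2 := (tendsto_const_nhds (x := η)).div h1 one_ne_zero
      rwa [div_one] at h2
    filter_upwards [eventually_ge_atTop 1, hlim.eventually (ge_mem_nhds hηK)] with n hn h1 i
    refine le_trans ?_ h1
    have hq := one_sub_pow_pos hα0 hα1 (show n ≠ 0 by omega)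
    calc A n i ≤ ε * η / ((1 - (ρ ^ 2) ^ n) * ε) :=
          div_le_div_of_nonneg_left hγ.le (mul_pos hq hε) (adamDenom_ge _ _ _ _ _)
      _ = η / (1 - (ρ ^ 2) ^ n) := by field_simp
  have hAρ : ∀ᶠ n in atTop, ∀ i, ρ * A (n + 1) i ≤ A n i := by
    filter_upwards [eventually_ge_atTop 1] with n hn i
    have h1 := h.mul_adamDenom_le hρ0.le hρ1.le hε.le (hM n hn i)
    simp only [hAdef]
    rw [← mul_div_assoc, div_le_div_iff₀ (hdpos (n + 1) (by omega) i) (hdpos n hn i)]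
    linarith [mul_le_mul_of_nonneg_left h1 hγ.le]
  have hΘ := h.update_eq hα0 hα1
  obtain ⟨⟨R, hR⟩, hQ⟩ := momentum_bounded_and_tendsto hd hκ hK hLip hcoer hρ0.le hρ1
    h.first_moment hΘ hA0 hAK hAρ
  have hGR : ∀ᶠ n in atTop, ‖∇ f (Θ n)‖ ≤ K * R := by
    filter_upwards [hR] with n hn
    have h1 := hLip (Θ n) ϑ
    rw [h0, sub_zero] at h1
    exact h1.trans (mul_le_mul_of_nonneg_left hn hK.le)
  choose D hD0 hD using h.adamDenom_bounded hα0 hα1 hε hGR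
  have hS0 : 0 ≤ ∑ i, D i := Finset.sum_nonneg fun i _ => (hD0 i).le
  -- The summand `1` keeps the denominator positive even for an empty sum.
  have hAlow : ∀ᶠ n in atTop, ∀ i, ε * η / (1 + ∑ i, D i) ≤ A n i := by
    filter_upwards [eventually_ge_atTop 1, eventually_all.2 hD] with n hn h1 i
    refine div_le_div_of_nonneg_left hγ.le (hdpos n hn i) ?_
    have := Finset.single_le_sum (f := D) (fun j _ => (hD0 j).le) (Finset.mem_univ i)
    linarith [h1 i]
  have hlim := momentum_tendsto hκ hcoer hρ0.le hρ1 h.first_moment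
    (div_pos hγ (by linarith : 0 < 1 + ∑ i, D i)) hAlow hQ
  have hGlim : Tendsto (fun n => ∇ f (Θ n)) atTop (nhds 0) := by
    have := (hLip'.continuous.tendsto ϑ).comp (tendsto_sub_nhds_zero_iff.1 hlim)
    rwa [h0] at this
  have hA : ∀ i, Tendsto (fun n => A n i) atTop (nhds η) := fun i => by
    have := (tendsto_const_nhds (x := ε * η)).div
      (tendsto_adamDenom hα0 hα1 (h.tendsto_second_moment hα0 hα1 hM hGlim i) (ε := ε)) hε.ne'
    rwa [mul_div_cancel_left₀ η hε.ne'] at this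
  obtain ⟨H, hH, hsymm⟩ := exists_hasFDerivAt_gradient_symmetric hf ϑ
  have hηK' : η * K < 1 / 4 := by
    have := mul_lt_mul_of_pos_right hηK hK
    rwa [show 1 / (4 * K) * K = 1 / 4 by field_simp] at this
  -- `s` is the upper bound for `S` coming from `H ≥ κ`; the bound `H ≤ K` with `η K < 1/4` keeps
  -- the form of `S` nonnegative.
  refine momentum_isBigO_pow hLip h0 hH hsymm (s := 1 + ρ ^ 2 - η * (1 - ρ ^ 2) * κ)
    (fun v => ?_) ?_ hρ0 hσ hη0.ne' h.first_moment hΘ hA hlim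
  · have h1 := inner_fderiv_gradient_ge_of_coercive hH h0 hcoer v
    have h2 : inner ℝ v (H v) ≤ K * ‖v‖ ^ 2 := by
      have hHn : ‖H‖ ≤ K := by
        simpa [Real.coe_toNNReal _ hK.le] using hH.le_of_lipschitz hLip'
      calc inner ℝ v (H v) ≤ ‖v‖ * ‖H v‖ := real_inner_le_norm _ _
        _ ≤ ‖v‖ * (K * ‖v‖) :=
          mul_le_mul_of_nonneg_left (H.le_of_opNorm_le hHn v) (norm_nonneg _)
        _ = K * ‖v‖ ^ 2 := by ring
    have hq : 0 < η * (1 - ρ ^ 2) := mul_pos hη0 hp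
    have h3 := mul_le_mul_of_nonneg_left h1 hq.le
    have h4 := mul_le_mul_of_nonneg_left h2 hq.le
    have h5 : η * (1 - ρ ^ 2) * (K * ‖v‖ ^ 2) ≤ 1 / 4 * ‖v‖ ^ 2 := by
      have h6 : η * (1 - ρ ^ 2) * K ≤ 1 / 4 := by
        have : 0 ≤ η * K * ρ ^ 2 := by positivity
        linarith
      rw [← mul_assoc]
      exact mul_le_mul_of_nonneg_right h6 (sq_nonneg _)
    have h7 : 0 ≤ ρ ^ 2 * ‖v‖ ^ 2 := by positivity
    rw [abs_of_nonneg (by linarith [sq_nonneg ‖v‖])]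
    linarith
  -- `s < 2ρ` reads `(1 - ρ)² < η κ (1 - ρ²)`, which is `hrate` times `1 - ρ`.
  · have h1 := mul_lt_mul_of_pos_left hrate (sub_pos.2 hρ1)
    linarith

theorem theorem4p6 (d : ℕ) (hd : 0 < d)
    (L : EuclideanSpace ℝ (Fin d) → ℝ) (hL : ContDiff ℝ 2 L)
    (ϑ : EuclideanSpace ℝ (Fin d)) (κ K : ℝ) (hκ : 0 < κ) (hK : 0 < K)
    (hLip : ∀ θ φ : EuclideanSpace ℝ (Fin d), ‖∇ L θ - ∇ L φ‖ ≤ K * ‖θ - φ‖)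
    (hcoer : ∀ θ : EuclideanSpace ℝ (Fin d), κ * ‖θ - ϑ‖ ^ 2 ≤ inner ℝ (θ - ϑ) (∇ L θ))
    (ε : ℝ) (hε : ε ∈ Set.Ioo (0 : ℝ) 1)
    (Θ m M : ℝ → ℝ → ℝ → ℕ → EuclideanSpace ℝ (Fin d))
    (hAdam : ∀ α ∈ Set.Ioo (0 : ℝ) 1, ∀ β ∈ Set.Ioo (0 : ℝ) 1, ∀ γ : ℝ,
      IsAdam (∇ L) α β γ ε (Θ α β γ) (m α β γ) (M α β γ))
    -- the square roots in the recursion are those of nonnegative numbers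
    (hM : ∀ α ∈ Set.Ioo (0 : ℝ) 1, ∀ β ∈ Set.Ioo (0 : ℝ) 1, ∀ γ : ℝ,
      ∀ n : ℕ, 1 ≤ n → ∀ i, 0 ≤ M α β γ n i) :
    ∀ γbar ∈ Set.Ioo (0 : ℝ) (1 / (4 * K)),
      ∃ α ∈ Set.Ioo (0 : ℝ) 1, ∃ β ∈ Set.Ioo (0 : ℝ) 1,
        ∀ δ : ℝ, 0 < δ →
          (⨅ γ ∈ Set.Ioo (0 : ℝ) γbar,
            limsup (fun n : ℕ =>
              ((((1 - γbar * κ) / (1 + γbar * κ) + δ) ^ (-(n : ℤ)) * ‖Θ α β γ n - ϑ‖ : ℝ) : EReal))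
              atTop) = 0 := by
  rintro γbar ⟨hγ0, hγK⟩
  have : Nonempty (Fin d) := ⟨⟨0, hd⟩⟩
  have hLip' : LipschitzWith K.toNNReal (∇ L) := LipschitzWith.of_dist_le_mul fun x y => by
    rw [dist_eq_norm, dist_eq_norm, Real.coe_toNNReal _ hK.le]; exact hLip x y
  have hκK : κ ≤ K := le_of_coercive_of_lipschitz hLip hcoer
    (gradient_eq_zero_of_coercive hκ hLip'.continuous hcoer)
  have hγκ0 : 0 < γbar * κ := mul_pos hγ0 hκ
  have hγκ1 : γbar * κ < 1 := by
    have h1 := mul_lt_mul_of_pos_right hγK hK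
    rw [show 1 / (4 * K) * K = 1 / 4 by field_simp] at h1
    linarith [mul_le_mul_of_nonneg_left hκK hγ0.le]
  set ρ : ℝ := (1 - γbar * κ) / (1 + γbar * κ) with hρ
  have hρ0 : 0 < ρ := div_pos (by linarith) (by linarith)
  have hρ1 : ρ < 1 := (div_lt_one (by linarith)).2 (by linarith)
  have hα : ρ ^ 2 ∈ Set.Ioo (0 : ℝ) 1 := ⟨by positivity, pow_lt_one₀ hρ0.le hρ1 two_ne_zero⟩
  -- `ρ` solves `1 - ρ = γbar κ (1 + ρ)`, so `η > γbar` makes the rate condition strict. The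
  -- assumption `ε < 1` allows this while the learning rate `ε η` stays below `γbar`.
  obtain ⟨η, hη1, hη2⟩ : ∃ η, γbar < η ∧ η < min (1 / (4 * K)) (γbar / ε) :=
    exists_between (lt_min hγK ((lt_div_iff₀ hε.1).2 (mul_lt_of_lt_one_right hγ0 hε.2)))
  have hη0 : 0 < η := hγ0.trans hη1
  have hrate : 1 - ρ < η * κ * (1 + ρ) := by
    have h1 : 1 - ρ = γbar * κ * (1 + ρ) := by
      rw [hρ]; field_simp; ring
    rw [h1]
    exact mul_lt_mul_of_pos_right (mul_lt_mul_of_pos_right hη1 hκ) (by linarith)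
  refine ⟨ρ ^ 2, hα, ρ ^ 2, hα, fun δ hδ => ?_⟩
  refine iInf_limsup_eq_zero (γ := ε * η)
    (fun γ n => mul_nonneg (zpow_nonneg (by linarith) _) (norm_nonneg _))
    ⟨mul_pos hε.1 hη0, ?_⟩ ?_
  · have := (lt_div_iff₀ hε.1).1 (hη2.trans_le (min_le_right _ _))
    linarith
  · exact tendsto_zpow_neg_mul_norm (σ := ρ + δ / 2) (by linarith) (by linarith)
      ((hAdam _ hα _ hα (ε * η)).isBigO_pow hL hκ hK hLip hcoer hρ0 hρ1 hη0
        (hη2.trans_le (min_le_left _ _)) hε.1 hrate (hM _ hα _ hα _) (by linarith))
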